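/- Consider matching markets with $n$ applicants and $n$ institutions. A type $t_a$ of an applicant $a$ is a strict ordering over some subset of the institutions; each institution has a strict priority order over all applicants; an outcome is a partial one-to-one matching. For fixed priorities, $\mathrm{DA}$ is the social choice function that maps a preference profile $t=(t_a)_a$ to the matching produced by applicant-proposing deferred acceptance. The menu of applicant $i$ with respect to $t_{-i}$ is the set of all partners (an institution, or "unmatched") that $i$ gets in $\mathrm{DA}(t_i',t_{-i})$ for some type $t_i'$. An extensive-form description is a finite directed graph with a single source, whose vertices are organized into layers $1,\dots,L$ so that every edge goes from some layer $j$ to layer $j+1$. Every vertex $v$ with at least two outgoing edges queries an applicant $a$ (a vertex with one outgoing edge may query an applicant or nobody) and has a transition function from types of $a$ to edges leaving $v$. The evaluation path on $t$ starts at the source and follows at every vertex that queries $a$ the edge given by $t_a$, and at a vertex that queries nobody its only outgoing edge, until it reaches a sink. Its memory requirement is $\log_2$ of the maximum number of vertices in a layer. It is applicant-proposing if for every evaluation path, every applicant $a$ and every $j$, the transition function of the $j$-th vertex on the path that queries $a$ depends only on the $j$-th institution on $a$'s list (or on the fact that the list has fewer than $j$ institutions). It is an individualized dictatorship description of $\mathrm{DA}$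 for applicant $i$ if its sinks are labeled by matchings such that the sink reached on each $t$ is labeled $\mathrm{DA}(t)$, and for some layer $k\in\{1,\dots,L\}$: no vertex before layer $k$ is a sink or queries $i$; and every vertex $v$ in layer $k$ queries $i$ and is labeled by a set which equals the menu of $i$ with respect to $t_{-i}$ whenever $v$ is on the evaluation path on $t$. Theorem. For every $n$ and every applicant $i$ there exist institution priorities (depending on $n$ and $i$) such that the following holds. (1) Any applicant-proposing individualized dictatorship extensive-form description of $\mathrm{DA}$ for $i$ requires $\Omega(n^2)$ memory: there are constants $c>0$ and $N$, independent of $i$ and of the description, such that for all $n\ge N$ its memory requirement is at least $cn^2$. (2) Hence, no applicant-linear individualized dictatorship description of $\mathrm{DA}$ for $i$ exists: for any choice of an applicant $i_n$ for each $n\geq 1$, there is no family $(D_n)_n$ of applicant-proposing extensive-form descriptions with memory requirement $O(n\log^{\alpha}n)$ for some constant $\alpha$ such that $D_n$ is an individualized dictatorship description of $\mathrm{DA}$ for $i_n$ for infinitely many $n$. -/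

import Mathlib

/-! ### Matching environments with `n` applicants and `n` institutions -/

/-- A type of an applicant: a strict ordering over some subset of the institutions (the acceptable
ones), written as a list without repetitions, favorite institution first. -/
abbrev PrefList (n : ℕ) : Type := {l : List (Fin n) // l.Nodup}

/-- A preference profile: one type for every applicant. -/
abbrev PrefProfile (n : ℕ) : Type := Fin n → PrefList n

/-- A strict priority order over all applicants for every institution: `prio h a` is the rank of
applicant `a` at institution `h`, where rank `0` is the top priority. -/
abbrev Priorities (n : ℕ) : Type := Fin n → Equiv.Perm (Fin n)

/-- A partial (one-to-one) matching of applicants to institutions; `partner a = none` means that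
applicant `a` is unmatched. -/
@[ext]
structure PartialMatching (n : ℕ) where
  partner : Fin n → Option (Fin n)
  injective_of_some : ∀ a b h, partner a = some h → partner b = some h → a = b

/-! ### Applicant-proposing deferred acceptance -/

/-- A state of the deferred acceptance algorithm: `rejections a` is the number of institutions that
have rejected applicant `a` so far (so these are the first `rejections a` entries of her list), and
`held h` is the applicant tentatively matched to institution `h`. -/
structure DAState (n : ℕ) where
  rejections : Fin n → ℕ
  held : Fin n → Option (Fin n)

/-- Initially nobody has been rejected and every institution is free. -/
def DAState.init (n : ℕ) : DAState n where
  rejections := fun _ => 0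
  held := fun _ => none

/-- Applicant `a` can propose: she is currently unmatched and has not exhausted her list. -/
def DAState.CanPropose {n : ℕ} (t : PrefProfile n) (σ : DAState n) (a : Fin n) : Prop :=
  (∀ h, σ.held h ≠ some a) ∧ σ.rejections a < (t a).1.length

instance {n : ℕ} (t : PrefProfile n) (σ : DAState n) (a : Fin n) :
    Decidable (σ.CanPropose t a) := by
  unfold DAState.CanPropose
  infer_instance

/-- The result of a proposal by `a` to `h`: of `a` and the applicant held so far (if any),
institution `h` holds the one of higher priority and rejects the other one. -/
def DAState.propose {n : ℕ} (prio : Priorities n) (σ : DAState n) (a h : Fin n) : DAState n :=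
  match σ.held h with
  | none => { σ with held := Function.update σ.held h (some a) }
  | some b =>
    if prio h a < prio h b then
      { rejections := Function.update σ.rejections b (σ.rejections b + 1)
        held := Function.update σ.held h (some a) }
    else
      { σ with rejections := Function.update σ.rejections a (σ.rejections a + 1) }

/-- One step of deferred acceptance: an unmatched applicant who has not exhausted her list (the
first one in the indexing; the final matching does not depend on this choice) proposes to her
favorite institution that has not yet rejected her. If there is no such applicant, nothing
changes. -/
def DAState.step {n : ℕ} (prio : Priorities n) (t : PrefProfile n) (σ : DAState n) : DAState n :=
  match (List.finRange n).find? (fun a => decide (σ.CanPropose t a)) with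
  | none => σ
  | some a =>
    match (t a).1[σ.rejections a]? with
    | none => σ
    | some h => σ.propose prio a h

/-- The state in which deferred acceptance stops. Every step increases the number of rejections
plus the number of matched institutions, so `n * n + n` steps suffice; see `daFinal_terminal`. -/
def daFinal {n : ℕ} (prio : Priorities n) (t : PrefProfile n) : DAState n :=
  (DAState.step prio t)^[n * n + n] (DAState.init n)

/-- The social choice function DA (applicant-proposing deferred acceptance) for fixed priorities:
the tentative matches become final when no more proposals can be made. -/
def DA {n : ℕ} (prio : Priorities n) (t : PrefProfile n) : PartialMatching n where
  partner a := (List.finRange n).find? (fun h => decide ((daFinal prio t).held h = some a))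
  injective_of_some := by
    intro a b h ha hb
    have ha' := List.find?_some ha
    have hb' := List.find?_some hb
    simp only [decide_eq_true_eq] at ha' hb'
    exact Option.some.inj (ha'.symm.trans hb')

/-- The number of rejections plus the number of matched institutions. -/
def DAState.progress {n : ℕ} (σ : DAState n) : ℕ :=
  ∑ a, σ.rejections a + ∑ h, (if (σ.held h).isSome then 1 else 0)

/-- An invariant of the algorithm, used to show that it has stopped. -/
def DAState.Valid {n : ℕ} (t : PrefProfile n) (σ : DAState n) : Prop :=
  (∀ a, σ.rejections a ≤ (t a).1.length) ∧
    (∀ h a, σ.held h = some a → σ.rejections a < (t a).1.length) ∧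
    ∀ h h' a, σ.held h = some a → σ.held h' = some a → h = h'

theorem DAState.valid_propose {n : ℕ} (prio : Priorities n) (t : PrefProfile n) (σ : DAState n)
    (a h : Fin n) (hσ : σ.Valid t) (ha : σ.CanPropose t a) : (σ.propose prio a h).Valid t := by
  obtain ⟨h1, h2, h3⟩ := hσ
  obtain ⟨ha1, ha2⟩ := ha
  have hu : ∀ h₁ h₂ c, Function.update σ.held h (some a) h₁ = some c →
      Function.update σ.held h (some a) h₂ = some c → h₁ = h₂ := by
    intro h₁ h₂ c e₁ e₂
    simp only [Function.update_apply] at e₁ e₂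
    grind
  unfold DAState.propose
  split
  · refine ⟨h1, fun h' b hb => ?_, hu⟩
    simp only [Function.update_apply] at hb
    grind
  · split
    · refine ⟨fun c => ?_, fun h' c hc => ?_, hu⟩
      · simp only [Function.update_apply]
        grind
      · simp only [Function.update_apply] at hc ⊢
        grind
    · refine ⟨fun c => ?_, fun h' c hc => ?_, h3⟩
      · simp only [Function.update_apply]
        grind
      · simp only [Function.update_apply] at hc ⊢
        grind

theorem DAState.progress_propose {n : ℕ} (prio : Priorities n) (σ : DAState n) (a h : Fin n) :
    (σ.propose prio a h).progress = σ.progress + 1 := by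
  have key : ∀ (f : Fin n → ℕ) (x : Fin n), ∑ y, Function.update f x (f x + 1) y = ∑ y, f y + 1 := by
    intro f x
    rw [Finset.sum_update_of_mem (Finset.mem_univ x),
      ← Finset.add_sum_erase Finset.univ f (Finset.mem_univ x), Finset.sdiff_singleton_eq_erase]
    omega
  unfold DAState.propose DAState.progress
  split
  · rename_i e
    have : (fun y => if (Function.update σ.held h (some a) y).isSome then 1 else 0)
        = Function.update (fun y => if (σ.held y).isSome then 1 else 0) h
          ((fun y => if (σ.held y).isSome then 1 else 0) h + 1) := by
      funext y
      by_cases hy : y = h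
      · subst hy
        simp [e]
      · simp [Function.update_of_ne hy]
    simp only [this, key]
    omega
  · rename_i b e
    split
    · have : (fun y => if (Function.update σ.held h (some a) y).isSome then 1 else 0)
          = (fun y => if (σ.held y).isSome then 1 else 0) := by
        funext y
        by_cases hy : y = h
        · subst hy
          simp [e]
        · simp [Function.update_of_ne hy]
      simp only [this, key]
      omega
    · simp only [key]
      omega

theorem DAState.progress_le {n : ℕ} (t : PrefProfile n) (σ : DAState n) (hσ : σ.Valid t) :
    σ.progress ≤ n * n + n := by
  unfold DAState.progress
  have h1 : ∑ a, σ.rejections a ≤ ∑ _a : Fin n, n := Finset.sum_le_sum fun a _ =>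
    (hσ.1 a).trans (by simpa using (t a).2.length_le_card)
  have h2 : ∑ h, (if (σ.held h).isSome then 1 else 0) ≤ ∑ _h : Fin n, 1 :=
    Finset.sum_le_sum fun h _ => by split <;> simp
  simp only [Finset.sum_const, Finset.card_univ, Fintype.card_fin, smul_eq_mul, mul_one] at h1 h2
  omega

/-- In the state in which the algorithm is stopped, no more proposals can be made. -/
theorem daFinal_terminal {n : ℕ} (prio : Priorities n) (t : PrefProfile n) (a : Fin n) :
    ¬ (daFinal prio t).CanPropose t a := by
  have main : ∀ m, ((DAState.step prio t)^[m] (DAState.init n)).Valid t ∧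
      ((∀ b, ¬ ((DAState.step prio t)^[m] (DAState.init n)).CanPropose t b) ∨
        m ≤ ((DAState.step prio t)^[m] (DAState.init n)).progress ∧
        ∃ b, ((DAState.step prio t)^[m] (DAState.init n)).CanPropose t b) := by
    intro m
    induction m with
    | zero =>
      refine ⟨⟨by simp [DAState.init], by simp [DAState.init], by simp [DAState.init]⟩, ?_⟩
      by_cases hb : ∃ b, (DAState.init n).CanPropose t b
      · exact Or.inr ⟨Nat.zero_le _, hb⟩
      · exact Or.inl (not_exists.mp hb)
    | succ m ih =>
      rw [Function.iterate_succ_apply']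
      generalize (DAState.step prio t)^[m] (DAState.init n) = σ at ih ⊢
      obtain ⟨hv, hs⟩ := ih
      rcases e : (List.finRange n).find? (fun a => decide (σ.CanPropose t a)) with _ | b
      · have hst : DAState.step prio t σ = σ := by simp [DAState.step, e]
        have hno : ∀ b, ¬ σ.CanPropose t b := by simpa using e
        rw [hst]
        exact ⟨hv, Or.inl hno⟩
      · have hb : σ.CanPropose t b := by simpa using List.find?_some e
        have hst : DAState.step prio t σ = σ.propose prio b ((t b).1[σ.rejections b]'hb.2) := by
          simp [DAState.step, e, List.getElem?_eq_getElem hb.2]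
        rw [hst]
        refine ⟨σ.valid_propose prio t b _ hv hb, ?_⟩
        rcases hs with hs | ⟨hs, -⟩
        · exact absurd hb (hs b)
        · rw [DAState.progress_propose]
          by_cases hc : ∃ c, (σ.propose prio b ((t b).1[σ.rejections b]'hb.2)).CanPropose t c
          · exact Or.inr ⟨by omega, hc⟩
          · exact Or.inl (not_exists.mp hc)
  obtain ⟨hv, hs | ⟨hs, b, hb⟩⟩ := main (n * n + n)
  · exact hs a
  · exfalso
    have hp := DAState.progress_le t _ (DAState.valid_propose prio t _ b b hv hb)
    rw [DAState.progress_propose] at hp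
    omega

/-! ### Extensive-form descriptions -/

/-- An extensive-form description for `n` players whose types are preference lists: a finite
layered directed graph whose vertices query the types of the players.

`out v` is the set of heads of the edges that leave `v`. A vertex with at least two outgoing edges
has to query a player; a vertex with exactly one outgoing edge may query a player or nobody; a sink
queries nobody. `trans v` is the transition function of a vertex that queries a player. (At a vertex
that queries nobody it carries no information: it takes the unique outgoing edge, if there is
one.) -/
structure ExtensiveFormDescription (n : ℕ) where
  V : Type
  [fintypeV : Fintype V]
  numLayers : ℕ
  layer : V → ℕ
  layer_mem : ∀ v, 1 ≤ layer v ∧ layer v ≤ numLayers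
  out : V → Set V
  layer_of_mem_out : ∀ v, ∀ w ∈ out v, layer w = layer v + 1
  source : V
  layer_source : layer source = 1
  source_iff : ∀ v, (∀ u, v ∉ out u) ↔ v = source
  query : V → Option (Fin n)
  out_subsingleton_of_query_eq_none : ∀ v, query v = none → (out v).Subsingleton
  out_nonempty_of_query_eq_some : ∀ v i, query v = some i → (out v).Nonempty
  trans : V → PrefList n → V
  trans_mem_out : ∀ v s, (out v).Nonempty → trans v s ∈ out v

namespace ExtensiveFormDescription

variable {n : ℕ} (D : ExtensiveFormDescription n)

/-- A sink: a vertex without outgoing edges. -/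
def IsSink (v : D.V) : Prop := D.out v = ∅

open Classical in
/-- The vertex that follows `v` on the evaluation path on `t`: a vertex that queries player `i`
applies its transition function to `t i`, and a vertex that queries nobody follows its unique
outgoing edge. We stay at a sink. -/
noncomputable def next (t : PrefProfile n) (v : D.V) : D.V :=
  if D.IsSink v then v
  else
    match D.query v with
    | some i => D.trans v (t i)
    | none => D.trans v ⟨[], List.nodup_nil⟩

/-- The vertex reached after `m` steps on the evaluation path on `t`; it is in layer `m + 1`,
unless the path has reached a sink before. -/
noncomputable def path (t : PrefProfile n) (m : ℕ) : D.V := (D.next t)^[m] D.source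

/-- The vertex `v` is on the evaluation path on `t`. -/
def OnPath (t : PrefProfile n) (v : D.V) : Prop := ∃ m, D.path t m = v

/-- The description is an outcome description of the social choice function `f`: sinks can be
labeled by outcomes so that the sink on the evaluation path on `t` always has label `f t`. -/
def IsOutcomeDescription (f : PrefProfile n → PartialMatching n) : Prop :=
  ∃ label : D.V → PartialMatching n, ∀ t v, D.OnPath t v → D.IsSink v → label v = f t

/-- The number of vertices querying player `i` among the first `m` vertices of the evaluation path
on `t`. -/
noncomputable def queryCount (t : PrefProfile n) (i : Fin n) (m : ℕ) : ℕ :=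
  ((Finset.range m).filter (fun m' => D.query (D.path t m') = some i)).card

/-- The description is applicant-proposing: on every evaluation path and for every applicant `i`,
the transition function of the `j`-th vertex on the path that queries `i` depends only on the `j`-th
institution on the list of `i` (or on the fact that the list has fewer than `j` institutions).
Positions are counted from `0`, so the vertex at step `m` of the path is the one with index
`queryCount t i m`. -/
def IsApplicantProposing : Prop :=
  ∀ (t : PrefProfile n) (i : Fin n) (m : ℕ), D.query (D.path t m) = some i →
    ∀ s s' : PrefList n, s.1[D.queryCount t i m]? = s'.1[D.queryCount t i m]? →
      D.trans (D.path t m) s = D.trans (D.path t m) s'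

/-- The memory requirement: the logarithm in base `2` of the maximum number of vertices in a
layer. -/
noncomputable def memory : ℝ :=
  letI := D.fintypeV
  Real.logb 2 (((Finset.Icc 1 D.numLayers).sup
    (fun j => (Finset.univ.filter (fun v : D.V => D.layer v = j)).card) : ℕ) : ℝ)

end ExtensiveFormDescription

/-- The menu of player `i` with respect to the types of the other players in `t`: all `i`-outcomes
(partners of `i`, or `none`) that `i` gets for some report of hers. The value `t i` is irrelevant. -/
def menu {n : ℕ} (f : PrefProfile n → PartialMatching n) (i : Fin n) (t : PrefProfile n) :
    Set (Option (Fin n)) :=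
  {x | ∃ s : PrefList n, (f (Function.update t i s)).partner i = x}

/-- `D` is an individualized dictatorship (extensive-form) description of `f` for player `i`: it is
an outcome description of `f` with a layer `k` such that no path ends before layer `k` and no vertex
before layer `k` queries `i`, while every vertex of layer `k` queries `i` and is labeled by the menu
of `i` for every type profile whose evaluation path visits it. -/
def ExtensiveFormDescription.IsIndividualizedDictatorship {n : ℕ} (D : ExtensiveFormDescription n)
    (f : PrefProfile n → PartialMatching n) (i : Fin n) : Prop :=
  D.IsOutcomeDescription f ∧
  ∃ k, 1 ≤ k ∧ k ≤ D.numLayers ∧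
    (∀ v, D.layer v < k → ¬ D.IsSink v ∧ D.query v ≠ some i) ∧
    (∀ v, D.layer v = k → D.query v = some i) ∧
    ∃ menuLabel : D.V → Set (Option (Fin n)),
      ∀ t v, D.layer v = k → D.OnPath t v → menuLabel v = menu f i t

/-- A family of extensive-form descriptions, one for every market size `n`, is applicant-linear: all
of them are applicant-proposing, and the memory requirement is `O(n * (log n) ^ k)` for some
constant `k`. -/
def IsApplicantLinear (D : (n : ℕ) → ExtensiveFormDescription n) : Prop :=
  (∀ n, (D n).IsApplicantProposing) ∧
  ∃ k : ℕ, (fun n => (D n).memory) =O[Filter.atTop] (fun n : ℕ => (n : ℝ) * Real.log n ^ k)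

/-! ### Stability and applicant-optimality of deferred acceptance -/

/-! An applicant-proposing description reads each list once, from the top, and cannot return to an
entry it has passed. If a part of the profile must be read before the menu of `i` is known, while
the outcome after the choice of `i` can still reveal all of it, then the layer that queries `i` has
to store that part.

`BitMarket` supplies `m * m` such bits. Its applicant groups 0, 1, 2, 3 are d, f, a, e and its
institution groups are h, w, c, y. The list of d j is h j followed by the c k with k in `S j`. If
`i` takes h j, then d j is evicted and passes through these c k, and exactly the corresponding a k
lose their c k; so each `S j` is visible in the outcome for some report of `i`. On the other hand, w
j appended to the list of d j removes h j from the menu: d j would take w j, and f j would return to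
h j and evict `i`. Hence every list of a d j is read to its end before `i` is queried, and the `2 ^
(m * m)` profiles reach different vertices of that layer. This is `logb_card_le_memory`, which rests
on `path_update` (unread entries do not matter) and `path_add` (nor do lists already exhausted).

Deferred acceptance is never simulated on the market. What `i` or a k cannot get follows from
constraints on all stable matchings (`DA_isStable`); that a k keeps c k for k outside `S j` follows
from an explicit stable matching (`isStable_probePartner`) and applicant-optimality
(`daFinal_rejections_le`). -/

/-- A stable matching: injective, individually rational, and without blocking pairs. -/
structure IsStable {n : ℕ} (prio : Priorities n) (t : PrefProfile n)
    (P : Fin n → Option (Fin n)) : Prop where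
  inj : ∀ a b h, P a = some h → P b = some h → a = b
  mem : ∀ a h, P a = some h → h ∈ (t a).1
  not_block : ∀ (a : Fin n) (p : ℕ) (h : Fin n), (t a).1[p]? = some h →
    (∃ q ≤ p, P a = (t a).1[q]?) ∨ ∃ b, P b = some h ∧ prio h b < prio h a

theorem daFinal_induction {n : ℕ} (prio : Priorities n) (t : PrefProfile n)
    (I : DAState n → Prop) (h0 : I (DAState.init n))
    (hs : ∀ σ a h, I σ → (t a).1[σ.rejections a]? = some h → σ.CanPropose t a →
      I (σ.propose prio a h)) :
    I (daFinal prio t) := by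
  have main : ∀ m, I ((DAState.step prio t)^[m] (DAState.init n)) := by
    intro m
    induction m with
    | zero => exact h0
    | succ m ih =>
      rw [Function.iterate_succ_apply']
      generalize (DAState.step prio t)^[m] (DAState.init n) = σ at ih ⊢
      unfold DAState.step
      split
      · exact ih
      · rename_i a e
        split
        · exact ih
        · rename_i h e'
          exact hs σ a h ih e' (by simpa using List.find?_some e)
  exact main _

/-- Held applicants are at the current position of their lists, and every institution that has
rejected an applicant holds somebody of higher priority. -/
structure DAState.Consistent {n : ℕ} (prio : Priorities n) (t : PrefProfile n)
    (σ : DAState n) : Prop where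
  held_eq : ∀ h a, σ.held h = some a → (t a).1[σ.rejections a]? = some h
  rejected : ∀ (a : Fin n) (p : ℕ) (h : Fin n), p < σ.rejections a → (t a).1[p]? = some h →
    ∃ b, σ.held h = some b ∧ prio h b < prio h a

/-- Institutions only trade up, so an old rejection stays justified by the current holder; the one
new rejection is justified by the comparison just made. -/
theorem DAState.Consistent.propose {n : ℕ} {prio : Priorities n} {t : PrefProfile n}
    {σ : DAState n} (hσ : σ.Consistent prio t) {a h : Fin n}
    (hah : (t a).1[σ.rejections a]? = some h) (ha : σ.CanPropose t a) :
    (σ.propose prio a h).Consistent prio t := by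
  obtain ⟨h1, h2⟩ := hσ
  obtain ⟨ha1, -⟩ := ha
  unfold DAState.propose
  split
  · rename_i e
    refine ⟨fun h' b hb => ?_, fun b p h' hp hb => ?_⟩
    · simp only [Function.update_apply] at hb
      grind
    · obtain ⟨x, hx, hx'⟩ := h2 b p h' hp hb
      refine ⟨x, ?_, hx'⟩
      simp only [Function.update_apply]
      grind
  · rename_i c e
    split
    · rename_i hlt
      have hac : a ≠ c := fun hac => ha1 h (hac ▸ e)
      refine ⟨fun h' b hb => ?_, fun b p h' hp hb => ?_⟩
      · simp only [Function.update_apply] at hb ⊢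
        grind
      · by_cases hh : h' = h
        · subst hh
          refine ⟨a, by simp, ?_⟩
          by_cases hbc : b = c
          · rwa [hbc]
          · simp only [Function.update_apply, hbc, if_false] at hp
            obtain ⟨x, hx, hx'⟩ := h2 b p h' hp hb
            obtain rfl : c = x := by simpa [e] using hx
            exact hlt.trans hx'
        · have hp' : p < σ.rejections b := by
            by_cases hbc : b = c
            · subst hbc
              -- The only new rejection of the displaced applicant is at her current entry, which is
              -- `h` itself.
              simp only [Function.update_self] at hp
              have := h1 h b e
              rcases Nat.lt_succ_iff_lt_or_eq.mp hp with hp | rfl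
              · exact hp
              · rw [hb] at this
                exact absurd (Option.some.inj this) hh
            · simpa only [Function.update_apply, hbc, if_false] using hp
          obtain ⟨x, hx, hx'⟩ := h2 b p h' hp' hb
          exact ⟨x, by simpa [Function.update_apply, hh] using hx, hx'⟩
    · rename_i hlt
      refine ⟨fun h' b hb => ?_, fun b p h' hp hb => ?_⟩
      · have hba : b ≠ a := fun hba => ha1 h' (hba ▸ hb)
        simpa [Function.update_apply, hba] using h1 h' b hb
      · by_cases hba : b = a
        · subst hba
          simp only [Function.update_self] at hp
          rcases Nat.lt_succ_iff_lt_or_eq.mp hp with hp | rfl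
          · exact h2 b p h' hp hb
          · obtain rfl : h = h' := by simpa [hah] using hb
            refine ⟨c, e, lt_of_le_of_ne (not_lt.mp hlt) fun hcb => ?_⟩
            exact ha1 h ((prio h).injective hcb ▸ e)
        · exact h2 b p h' (by simpa [Function.update_apply, hba] using hp) hb

theorem daFinal_consistent {n : ℕ} (prio : Priorities n) (t : PrefProfile n) :
    (daFinal prio t).Consistent prio t :=
  daFinal_induction prio t (fun σ => σ.Consistent prio t)
    ⟨by simp [DAState.init], by simp [DAState.init]⟩
    fun _ _ _ hσ hah ha => hσ.propose hah ha

theorem DA_partner_eq_some_iff {n : ℕ} (prio : Priorities n) (t : PrefProfile n) (a h : Fin n) :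
    (DA prio t).partner a = some h ↔ (daFinal prio t).held h = some a := by
  constructor
  · intro e
    simpa using List.find?_some e
  · intro e
    have hx : ((DA prio t).partner a).isSome := by
      simp only [DA, List.find?_isSome]
      exact ⟨h, List.mem_finRange h, by simpa using e⟩
    obtain ⟨h', e'⟩ := Option.isSome_iff_exists.mp hx
    have e'' : (daFinal prio t).held h' = some a := by simpa using List.find?_some e'
    have hc := (daFinal_consistent prio t).held_eq
    rw [e', ← hc h' a e'', hc h a e]

/-- The unmatched case is included: by termination an unmatched applicant has exhausted her list, so
the lookup gives `none`. -/
theorem DA_partner_eq_getElem? {n : ℕ} (prio : Priorities n) (t : PrefProfile n) (a : Fin n) :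
    (DA prio t).partner a = (t a).1[(daFinal prio t).rejections a]? := by
  rcases e : (DA prio t).partner a with _ | h
  · have hno : ∀ h, (daFinal prio t).held h ≠ some a := fun h hh => by
      rw [← DA_partner_eq_some_iff, e] at hh
      cases hh
    have := daFinal_terminal prio t a
    simp only [DAState.CanPropose, not_and, not_lt] at this
    exact (List.getElem?_eq_none (this hno)).symm
  · exact ((daFinal_consistent prio t).held_eq h a ((DA_partner_eq_some_iff ..).mp e)).symm

theorem DA_isStable {n : ℕ} (prio : Priorities n) (t : PrefProfile n) :
    IsStable prio t (DA prio t).partner where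
  inj := (DA prio t).injective_of_some
  mem a h e := by
    rw [DA_partner_eq_getElem?] at e
    exact List.mem_of_getElem? e
  not_block a p h hp := by
    by_cases hlt : p < (daFinal prio t).rejections a
    · obtain ⟨b, hb, hb'⟩ := (daFinal_consistent prio t).rejected a p h hlt hp
      exact Or.inr ⟨b, (DA_partner_eq_some_iff ..).mpr hb, hb'⟩
    · exact Or.inl ⟨_, not_lt.mp hlt, DA_partner_eq_getElem? prio t a⟩

/-- No institution rejects an applicant to whom it is matched in some stable matching. -/
theorem daFinal_rejections_le {n : ℕ} {prio : Priorities n} {t : PrefProfile n}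
    {P : Fin n → Option (Fin n)} (hP : IsStable prio t P) {a h : Fin n} {p : ℕ}
    (hah : P a = some h) (hp : (t a).1[p]? = some h) : (daFinal prio t).rejections a ≤ p := by
  have key : (daFinal prio t).Consistent prio t ∧
      ∀ a p h, p < (daFinal prio t).rejections a → P a = some h → (t a).1[p]? ≠ some h := by
    -- If `h` preferred `y` to its `P`-partner `x`, then `y` and `h` would block `P`, since `y` has
    -- not yet been rejected by her own `P`-partner and so does not prefer that partner to `h`.
    have noreject : ∀ σ : DAState n, (∀ a p h, p < σ.rejections a → P a = some h →
        (t a).1[p]? ≠ some h) → ∀ x y h, (t y).1[σ.rejections y]? = some h →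
        prio h y < prio h x → P x ≠ some h := by
      intro σ hσ x y h hy hlt hx
      rcases hP.not_block y _ h hy with ⟨q, hq, e⟩ | ⟨b, hb, hb'⟩
      · rcases hq.lt_or_eq with hq | rfl
        · rcases e' : P y with _ | h'
          · rw [e', eq_comm, List.getElem?_eq_none_iff] at e
            have := (List.getElem?_eq_some_iff.mp hy).1
            omega
          · exact hσ y q h' hq e' (by rw [← e, e'])
        · rw [hy] at e
          rw [hP.inj x y h hx e] at hlt
          exact lt_irrefl _ hlt
      · rw [hP.inj b x h hb hx] at hb'
        exact lt_asymm hb' hlt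
    refine daFinal_induction prio t (fun σ => σ.Consistent prio t ∧
      ∀ a p h, p < σ.rejections a → P a = some h → (t a).1[p]? ≠ some h)
      ⟨⟨by simp [DAState.init], by simp [DAState.init]⟩, by simp [DAState.init]⟩ ?_
    rintro σ a h ⟨hc, hσ⟩ hah ha
    refine ⟨hc.propose hah ha, ?_⟩
    have upd : ∀ x y, (t y).1[σ.rejections y]? = some h → prio h y < prio h x →
        (t x).1[σ.rejections x]? = some h →
        ∀ b p h', p < Function.update σ.rejections x (σ.rejections x + 1) b → P b = some h' →
          (t b).1[p]? ≠ some h' := by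
      intro x y hy hlt hx b p h' hp hb
      by_cases hbx : b = x
      · subst hbx
        simp only [Function.update_self] at hp
        rcases Nat.lt_succ_iff_lt_or_eq.mp hp with hp | rfl
        · exact hσ b p h' hp hb
        · intro e
          obtain rfl : h = h' := by simpa [hx] using e
          exact noreject σ hσ b y h hy hlt hb
      · exact hσ b p h' (by simpa [Function.update_apply, hbx] using hp) hb
    unfold DAState.propose
    split
    · exact hσ
    · rename_i c e
      have hcc := hc.held_eq h c e
      split
      · rename_i hlt
        exact upd c a hah hlt hcc
      · rename_i hlt
        refine upd a c hcc (lt_of_le_of_ne (not_lt.mp hlt) fun hca => ?_) hah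
        exact ha.1 h ((prio h).injective hca ▸ e)
  by_contra hlt
  exact key.2 a p h (not_le.mp hlt) hah hp

/-! ### Evaluation paths before and after the layer that queries the distinguished player -/

namespace ExtensiveFormDescription

variable {n : ℕ} (D : ExtensiveFormDescription n)

theorem path_succ (t : PrefProfile n) (m : ℕ) : D.path t (m + 1) = D.next t (D.path t m) :=
  Function.iterate_succ_apply' ..

theorem layer_next {t : PrefProfile n} {v : D.V} (hv : ¬ D.IsSink v) :
    D.layer (D.next t v) = D.layer v + 1 := by
  apply D.layer_of_mem_out
  have hne : (D.out v).Nonempty := Set.nonempty_iff_ne_empty.mpr hv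
  unfold next
  rw [if_neg hv]
  split <;> exact D.trans_mem_out _ _ hne

theorem isSink_of_path_isSink {t : PrefProfile n} {m m' : ℕ} (hm : m ≤ m')
    (hs : D.IsSink (D.path t m)) : D.IsSink (D.path t m') := by
  induction m', hm using Nat.le_induction with
  | base => exact hs
  | succ k _ ih =>
    rw [path_succ, next, if_pos ih]
    exact ih

theorem layer_path {t : PrefProfile n} {m : ℕ} (h : ∀ m' < m, ¬ D.IsSink (D.path t m')) :
    D.layer (D.path t m) = m + 1 := by
  induction m with
  | zero => exact D.layer_source
  | succ m ih =>
    rw [path_succ, D.layer_next (h m m.lt_succ_self), ih fun m' hm' => h m' (hm'.trans m.lt_succ_self)]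

theorem isSink_path_of_numLayers_le (t : PrefProfile n) {m : ℕ} (hm : D.numLayers ≤ m) :
    D.IsSink (D.path t m) := by
  by_contra hs
  have := D.layer_path (t := t) (m := m) fun m' hm' h => hs (D.isSink_of_path_isSink hm'.le h)
  have := (D.layer_mem (D.path t m)).2
  omega

theorem layer_path_of_le {k : ℕ} (hk : ∀ v, D.layer v < k → ¬ D.IsSink v) (t : PrefProfile n)
    {m : ℕ} (hm : m < k) : D.layer (D.path t m) = m + 1 := by
  induction m with
  | zero => exact D.layer_source
  | succ m ih =>
    have := ih (by omega)
    rw [path_succ, D.layer_next (hk _ (by omega)), this]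

theorem queryCount_mono (t : PrefProfile n) (x : Fin n) {m m' : ℕ} (h : m ≤ m') :
    D.queryCount t x m ≤ D.queryCount t x m' :=
  Finset.card_le_card (Finset.filter_subset_filter _ (Finset.range_subset_range.mpr h))

theorem queryCount_lt (t : PrefProfile n) (x : Fin n) {m m' : ℕ} (h : m < m')
    (hq : D.query (D.path t m) = some x) : D.queryCount t x m < D.queryCount t x m' := by
  refine lt_of_lt_of_le ?_ (D.queryCount_mono t x h)
  unfold queryCount
  rw [Finset.range_add_one, Finset.filter_insert, if_pos hq, Finset.card_insert_of_notMem (by simp)]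
  exact Nat.lt_succ_self _

theorem queryCount_congr {t t' : PrefProfile n} {M : ℕ} (h : ∀ m < M, D.path t' m = D.path t m)
    (x : Fin n) : D.queryCount t' x M = D.queryCount t x M := by
  unfold queryCount
  congr 1
  refine Finset.filter_congr fun m hm => ?_
  rw [h m (Finset.mem_range.mp hm)]

variable {D}

/-- Changes of a list beyond the positions that have been queried do not change the path. -/
theorem IsApplicantProposing.path_update (hD : D.IsApplicantProposing) (t : PrefProfile n)
    (x : Fin n) (s : PrefList n) (M : ℕ)
    (h : ∀ p < D.queryCount t x M, s.1[p]? = (t x).1[p]?) :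
    ∀ m ≤ M, D.path (Function.update t x s) m = D.path t m := by
  intro m
  induction m with
  | zero => exact fun _ => rfl
  | succ m ih =>
    intro hm
    rw [path_succ, path_succ, ih (by omega)]
    unfold next
    by_cases hs : D.IsSink (D.path t m)
    · rw [if_pos hs, if_pos hs]
    · rw [if_neg hs, if_neg hs]
      rcases e : D.query (D.path t m) with _ | y
      · rfl
      · by_cases hy : y = x
        · subst hy
          simp only [Function.update_self]
          exact hD t y m e _ _ (h _ (D.queryCount_lt t y hm e))
        · simp only [Function.update_of_ne hy]

/-- Two paths that meet when all the lists in which the profiles differ have been read to the end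
stay together. -/
theorem IsApplicantProposing.path_add (hD : D.IsApplicantProposing) {t t' : PrefProfile n} {M : ℕ}
    (hM : D.path t M = D.path t' M)
    (h : ∀ x, t x = t' x ∨ (t x).1.length ≤ D.queryCount t x M ∧
      (t' x).1.length ≤ D.queryCount t' x M) (m : ℕ) :
    D.path t (M + m) = D.path t' (M + m) := by
  induction m with
  | zero => exact hM
  | succ m ih =>
    rw [← add_assoc, path_succ, path_succ, ← ih]
    unfold next
    by_cases hs : D.IsSink (D.path t (M + m))
    · rw [if_pos hs, if_pos hs]
    · rw [if_neg hs, if_neg hs]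
      rcases e : D.query (D.path t (M + m)) with _ | y
      · rfl
      · rcases h y with hy | ⟨h1, h2⟩
        · simp only [hy]
        · have e1 := hD t y (M + m) e (t y) ⟨[], List.nodup_nil⟩ (by
            simpa using h1.trans (D.queryCount_mono t y (Nat.le_add_right M m)))
          have e2 := hD t' y (M + m) (ih ▸ e) (t' y) ⟨[], List.nodup_nil⟩ (by
            simpa using h2.trans (D.queryCount_mono t' y (Nat.le_add_right M m)))
          simp only [e1]
          rw [← ih] at e2
          exact e2.symm

/-! ### Counting vertices in the layer that queries the distinguished player -/

variable (D)

theorem card_layer_le {j : ℕ} (h1 : 1 ≤ j) (h2 : j ≤ D.numLayers) {X : Type*} [Fintype X]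
    [Nonempty X] (F : X → D.V) (hF : Function.Injective F) (hl : ∀ x, D.layer (F x) = j) :
    Real.logb 2 (Fintype.card X) ≤ D.memory := by
  classical
  let := D.fintypeV
  unfold memory
  have hX : 0 < Fintype.card X := Fintype.card_pos
  refine Real.logb_le_logb_of_le (by norm_num) (by exact_mod_cast hX) ?_
  norm_cast
  refine le_trans ?_ (Finset.le_sup (f := fun j => (Finset.univ.filter
    (fun v : D.V => D.layer v = j)).card) (Finset.mem_Icc.mpr ⟨h1, h2⟩))
  rw [← Finset.card_univ, ← Finset.card_image_of_injective _ hF]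
  refine Finset.card_le_card fun v hv => ?_
  obtain ⟨x, -, rfl⟩ := Finset.mem_image.mp hv
  simpa using hl x

/-- A lower bound on the memory of applicant-proposing individualized dictatorship descriptions: if
the outcome, as a function of the type of player `i`, distinguishes the profiles of a family, and
extending any list in which profiles of the family may differ can change the menu of `i`, then the
members of the family lead to different vertices. -/
theorem logb_card_le_memory {f : PrefProfile n → PartialMatching n} {i : Fin n}
    (hD : D.IsApplicantProposing) (hf : D.IsIndividualizedDictatorship f i)
    {X : Type*} [Fintype X] [Nonempty X] (T : X → PrefProfile n) (A : Set (Fin n))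
    (hA : ∀ x y, ∀ a ∉ A, T x a = T y a)
    (hmenu : ∀ x, ∀ a ∈ A, ∃ s : PrefList n, (∀ p < (T x a).1.length, s.1[p]? = (T x a).1[p]?) ∧
      menu f i (Function.update (T x) a s) ≠ menu f i (T x))
    (hinj : ∀ x y, (∀ s, f (Function.update (T x) i s) = f (Function.update (T y) i s)) → x = y) :
    Real.logb 2 (Fintype.card X) ≤ D.memory := by
  obtain ⟨⟨label, hlabel⟩, k, hk1, hk2, hbefore, hat, menuLabel, hmenuLabel⟩ := hf
  obtain ⟨M, rfl⟩ : ∃ M, k = M + 1 := ⟨k - 1, by omega⟩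
  have hlayer : ∀ t, ∀ m < M + 1, D.layer (D.path t m) = m + 1 := fun t m hm =>
    D.layer_path_of_le (fun v hv => (hbefore v hv).1) t hm
  have hcount : ∀ t, D.queryCount t i M = 0 := fun t => by
    refine Finset.card_eq_zero.mpr (Finset.filter_eq_empty_iff.mpr fun m hm => ?_)
    have hm := Finset.mem_range.mp hm
    exact (hbefore _ (by rw [hlayer t m (by omega)]; omega)).2
  have hpath_i : ∀ t s, ∀ m ≤ M, D.path (Function.update t i s) m = D.path t m := fun t s =>
    hD.path_update t i s M (by simp [hcount])
  -- Were the list of `a` not read to its end, the profile with the extended list would reach the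
  -- same vertex of layer `M + 1`, whose single label cannot equal two different menus.
  have hread : ∀ x, ∀ a ∈ A, (T x a).1.length ≤ D.queryCount (T x) a M := by
    intro x a ha
    by_contra hlt
    obtain ⟨s, hs, hne⟩ := hmenu x a ha
    have hp := hD.path_update (T x) a s M (fun p hp => hs p (by omega)) M le_rfl
    apply hne
    rw [← hmenuLabel (T x) (D.path (T x) M) (hlayer _ M (by omega)) ⟨M, rfl⟩,
      ← hmenuLabel _ (D.path (T x) M) (hlayer _ M (by omega)) ⟨M, hp⟩]
  refine D.card_layer_le hk1 hk2 (fun x => D.path (T x) M) (fun x y hxy => ?_)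
    fun x => hlayer _ M (by omega)
  refine hinj x y fun s => ?_
  have hc : ∀ z a, D.queryCount (Function.update (T z) i s) a M = D.queryCount (T z) a M :=
    fun z a => D.queryCount_congr (fun m hm => hpath_i _ _ m hm.le) a
  -- If two profiles met at step `M`, their paths would stay together for every report of `i`;
  -- `numLayers` further steps certainly reach a sink, whose label is the common outcome.
  have hend := hD.path_add (t := Function.update (T x) i s) (t' := Function.update (T y) i s)
    (M := M) (by rw [hpath_i _ _ M le_rfl, hpath_i _ _ M le_rfl]; exact hxy) (by
      intro a
      by_cases hai : a = i
      · left; simp [hai]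
      · rw [hc, hc, Function.update_of_ne hai, Function.update_of_ne hai]
        by_cases ha : a ∈ A
        · exact Or.inr ⟨hread x a ha, hread y a ha⟩
        · exact Or.inl (hA x y a ha)) D.numLayers
  have hsink := D.isSink_path_of_numLayers_le (Function.update (T x) i s)
    (m := M + D.numLayers) (by omega)
  rw [← hlabel _ _ ⟨_, rfl⟩ hsink, ← hlabel _ _ ⟨_, hend.symm⟩ hsink]

end ExtensiveFormDescription

/-! ### A market in which many bits have to be remembered -/

/-- Lets priorities be prescribed by a coarse ranking, with ties broken arbitrarily. -/
theorem exists_perm_lt_of_lt {n : ℕ} (key : Fin n → ℕ) :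
    ∃ π : Equiv.Perm (Fin n), ∀ a b, key a < key b → π a < π b := by
  refine ⟨(Tuple.sort key).symm, fun a b hab => ?_⟩
  by_contra h
  have := Tuple.monotone_sort key (not_lt.mp h)
  simp only [Function.comp_apply, Equiv.apply_symm_apply] at this
  omega

/-- A market with four groups of `m` applicants and four groups of `m` institutions next to
applicant `i`. If `i` proposes to `h j`, then `d j` is rejected and works through her list; each
`c k` on this list makes `a k` and `e k` exchange their institutions `c k` and `y k`, after which
`d j` is rejected by `c k`. If the list ends with `w j`, then `f j` is displaced and returns to
`h j`, which rejects `i`. -/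
structure BitMarket {n : ℕ} (m : ℕ) (prio : Priorities n) (i : Fin n) where
  app : Fin 4 × Fin m → Fin n
  inst : Fin 4 × Fin m → Fin n
  app_injective : Function.Injective app
  inst_injective : Function.Injective inst
  app_ne : ∀ r, app r ≠ i
  prio_h_f : ∀ j, ∀ x ≠ app (1, j), prio (inst (0, j)) (app (1, j)) < prio (inst (0, j)) x
  prio_h_i : ∀ j, ∀ x ≠ app (1, j), x ≠ i → prio (inst (0, j)) i < prio (inst (0, j)) x
  prio_w : ∀ j, ∀ x ≠ app (0, j), prio (inst (1, j)) (app (0, j)) < prio (inst (1, j)) x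
  prio_c_e : ∀ k, ∀ x ≠ app (3, k), prio (inst (2, k)) (app (3, k)) < prio (inst (2, k)) x
  prio_c_a : ∀ k, ∀ x ≠ app (2, k), prio (inst (2, k)) x < prio (inst (2, k)) (app (2, k))
  prio_y : ∀ k, ∀ x ≠ app (2, k), prio (inst (3, k)) (app (2, k)) < prio (inst (3, k)) x

theorem exists_bitMarket {n m : ℕ} (hm : 4 * m + 1 ≤ n) (i : Fin n) :
    ∃ prio : Priorities n, Nonempty (BitMarket m prio i) := by
  obtain ⟨φ⟩ : Nonempty (Option (Fin 4 × Fin m) ↪ Fin n) :=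
    Function.Embedding.nonempty_of_card_le (by simpa using hm)
  -- The swap moves the image of `none` to `i`. The same indices then serve as applicants and as
  -- institutions.
  set ψ : Option (Fin 4 × Fin m) → Fin n := fun r => Equiv.swap (φ none) i (φ r) with hψ
  have ψinj : Function.Injective ψ := (Equiv.injective _).comp φ.injective
  have ψnone : ψ none = i := by simp [hψ]
  set app : Fin 4 × Fin m → Fin n := fun r => ψ (some r) with happ
  have inj : Function.Injective app := ψinj.comp (Option.some_injective _)
  have hne : ∀ r, app r ≠ i := fun r h => by
    rw [← ψnone] at h
    exact absurd (ψinj h) (by simp)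
  let key : Fin 4 × Fin m → Fin n → ℕ := fun r x =>
    if r.1 = 0 then if x = app (1, r.2) then 0 else if x = i then 1 else 2
    else if r.1 = 1 then if x = app (0, r.2) then 0 else 1
    else if r.1 = 2 then if x = app (3, r.2) then 0 else if x = app (2, r.2) then 2 else 1
    else if x = app (2, r.2) then 0 else 1
  choose π hπ using fun r => exists_perm_lt_of_lt (key r)
  have hp : ∀ r, Function.extend app π (fun _ => 1) (app r) = π r := fun r =>
    inj.extend_apply _ _ r
  refine ⟨Function.extend app π fun _ => 1, ⟨⟨app, app, inj, inj, hne, ?_, ?_, ?_, ?_, ?_, ?_⟩⟩⟩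
  all_goals intro j x hx
  · rw [hp]
    refine hπ _ _ _ ?_
    simp only [key, if_true, if_neg hx]
    split <;> omega
  · intro hx'
    rw [hp]
    refine hπ _ _ _ ?_
    simp [key, hx, hx', (hne _).symm]
  · rw [hp]
    refine hπ _ _ _ ?_
    simp [key, hx]
  · rw [hp]
    refine hπ _ _ _ ?_
    simp only [key, if_neg hx]
    simp
    split <;> omega
  · rw [hp]
    refine hπ _ _ _ ?_
    have h23 : app (2, j) ≠ app (3, j) := inj.ne (by simp)
    simp [key, hx, h23]
    split <;> omega
  · rw [hp]
    refine hπ _ _ _ ?_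
    simp [key, hx]

/-! ### Profiles that encode the bits, and their stable matchings -/

namespace BitMarket

variable {n m : ℕ} {prio : Priorities n} {i : Fin n} (B : BitMarket m prio i)

/-- The types of the four groups of applicants, where `S j` is the set of bits encoded in the list of
`d j`. -/
noncomputable def groupList (S : Fin m → Finset (Fin m)) (r : Fin 4 × Fin m) : List (Fin n) :=
  if r.1 = 0 then B.inst (0, r.2) :: (S r.2).toList.map fun k => B.inst (2, k)
  else if r.1 = 1 then [B.inst (1, r.2), B.inst (0, r.2)]
  else if r.1 = 2 then [B.inst (2, r.2), B.inst (3, r.2)]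
  else [B.inst (3, r.2), B.inst (2, r.2)]

theorem nodup_groupList (S : Fin m → Finset (Fin m)) (r : Fin 4 × Fin m) :
    (B.groupList S r).Nodup := by
  have hc : Function.Injective fun k => B.inst (2, k) := fun k k' h => by
    simpa using B.inst_injective h
  unfold groupList
  split_ifs <;> simp [B.inst_injective.eq_iff, List.nodup_map_iff hc, Finset.nodup_toList]

/-- The profile encoding the bits `S`; applicants outside of the four groups list no
institutions. -/
noncomputable def profile (S : Fin m → Finset (Fin m)) : PrefProfile n :=
  Function.extend B.app (fun r => ⟨B.groupList S r, B.nodup_groupList S r⟩)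
    fun _ => ⟨[], List.nodup_nil⟩

theorem profile_app (S : Fin m → Finset (Fin m)) (r : Fin 4 × Fin m) :
    (B.profile S (B.app r)).1 = B.groupList S r := by
  unfold profile
  rw [B.app_injective.extend_apply]

theorem profile_of_not_exists (S : Fin m → Finset (Fin m)) {x : Fin n} (hx : ¬ ∃ r, B.app r = x) :
    (B.profile S x).1 = [] := by
  unfold profile
  rw [Function.extend_apply' _ _ _ hx]

/-- The list of `d j`, extended by `w j`. -/
noncomputable def longList (S : Fin m → Finset (Fin m)) (j : Fin m) : PrefList n :=
  ⟨B.groupList S (0, j) ++ [B.inst (1, j)], by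
    rw [List.nodup_append]
    refine ⟨B.nodup_groupList S _, by simp, ?_⟩
    simp [groupList, B.inst_injective.eq_iff]⟩

/-- In a stable matching no applicant other than `a k` and `e k` is matched to `c k`. -/
theorem eq_of_partner_c {t : PrefProfile n} {P : Fin n → Option (Fin n)} (hP : IsStable prio t P)
    {k : Fin m} (ha : (t (B.app (2, k))).1 = [B.inst (2, k), B.inst (3, k)])
    (he : (t (B.app (3, k))).1 = [B.inst (3, k), B.inst (2, k)])
    {x : Fin n} (hx : P x = some (B.inst (2, k))) : x = B.app (2, k) ∨ x = B.app (3, k) := by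
  by_contra! hne
  -- If a third applicant held c k, then e k, who is first at c k, would need y k; but a k is first
  -- at y k, and both entries of her list would be taken.
  have he' : P (B.app (3, k)) = some (B.inst (3, k)) := by
    rcases hP.not_block (B.app (3, k)) 1 (B.inst (2, k)) (by simp [he]) with ⟨q, hq, e⟩ | ⟨b, hb, hlt⟩
    · rw [he] at e
      interval_cases q
      · simpa using e
      · exact absurd (hP.inj _ _ _ hx (by simpa using e)) hne.2
    · obtain rfl := hP.inj _ _ _ hx hb
      exact absurd (B.prio_c_e k x hne.2) hlt.asymm
  have h23 : B.app (2, k) ≠ B.app (3, k) := B.app_injective.ne (by simp)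
  rcases hP.not_block (B.app (2, k)) 1 (B.inst (3, k)) (by simp [ha]) with ⟨q, hq, e⟩ | ⟨b, hb, hlt⟩
  · rw [ha] at e
    interval_cases q
    · exact hne.1 (hP.inj _ _ _ hx (by simpa using e))
    · exact h23 (hP.inj _ _ _ (by simpa using e) he')
  · obtain rfl := hP.inj _ _ _ he' hb
    exact absurd (B.prio_y k _ h23.symm) hlt.asymm

/-- If the list of `d j` ends with `w j`, then `i` is not matched to `h j` in a stable matching. -/
theorem partner_ne_of_longList {S : Fin m → Finset (Fin m)} {j : Fin m} {t : PrefProfile n}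
    (ht : ∀ r, r ≠ (0, j) → (t (B.app r)).1 = B.groupList S r)
    (hj : t (B.app (0, j)) = B.longList S j) {P : Fin n → Option (Fin n)}
    (hP : IsStable prio t P) : P i ≠ some (B.inst (0, j)) := by
  intro hi
  -- Since f j is first at h j, which `i` holds, she must be at w j. Then d j, who is first at w j,
  -- must be matched, yet h j, every c k and w j are all unavailable to her.
  have hf : P (B.app (1, j)) = some (B.inst (1, j)) := by
    rcases hP.not_block (B.app (1, j)) 1 (B.inst (0, j)) (by rw [ht _ (by simp)]; simp [groupList])
      with ⟨q, hq, e⟩ | ⟨b, hb, hlt⟩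
    · rw [ht _ (by simp)] at e
      interval_cases q
      · simpa [groupList] using e
      · exact absurd (hP.inj _ _ _ hi (by simpa [groupList] using e)) (B.app_ne _).symm
    · obtain rfl := hP.inj _ _ _ hi hb
      exact absurd (B.prio_h_f j i (B.app_ne _).symm) hlt.asymm
  have h01 : B.app (0, j) ≠ B.app (1, j) := B.app_injective.ne (by simp)
  have hd : ∃ h, P (B.app (0, j)) = some h := by
    rcases hP.not_block (B.app (0, j)) (B.groupList S (0, j)).length (B.inst (1, j))
      (by simp [hj, longList]) with ⟨q, hq, e⟩ | ⟨b, hb, hlt⟩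
    · rw [e, hj, List.getElem?_eq_getElem (by simp [longList]; omega)]
      exact ⟨_, rfl⟩
    · obtain rfl := hP.inj _ _ _ hf hb
      exact absurd (B.prio_w j _ h01.symm) hlt.asymm
  obtain ⟨h, hd⟩ := hd
  have hmem := hP.mem _ _ hd
  rw [hj] at hmem
  simp only [longList, groupList, if_true, List.cons_append, List.mem_cons, List.mem_append,
    List.mem_map, List.not_mem_nil, or_false] at hmem
  rcases hmem with rfl | ⟨k, -, rfl⟩ | rfl
  · exact B.app_ne _ (hP.inj _ _ _ hd hi)
  · rcases B.eq_of_partner_c hP (by rw [ht _ (by simp)]; simp [groupList])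
      (by rw [ht _ (by simp)]; simp [groupList]) hd with e | e
    · simpa using B.app_injective e
    · simpa using B.app_injective e
  · exact h01 (hP.inj _ _ _ hd hf)

/-- The type of `i` that lists only `h j`. -/
def single (j : Fin m) : PrefList n := ⟨[B.inst (0, j)], List.nodup_singleton _⟩

/-- The profile in which `i` proposes to `h j`. -/
noncomputable def probe (S : Fin m → Finset (Fin m)) (j : Fin m) : PrefProfile n :=
  Function.update (B.profile S) i (B.single j)

theorem probe_app (S : Fin m → Finset (Fin m)) (j : Fin m) (r : Fin 4 × Fin m) :
    (B.probe S j (B.app r)).1 = B.groupList S r := by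
  rw [probe, Function.update_of_ne (B.app_ne r), profile_app]

theorem probe_self (S : Fin m → Finset (Fin m)) (j : Fin m) :
    (B.probe S j i).1 = [B.inst (0, j)] := by
  rw [probe, Function.update_self, single]

/-- An institution `w l` is only listed by `f l`. -/
theorem eq_of_mem_probe_w {S : Fin m → Finset (Fin m)} {j l : Fin m} {x : Fin n}
    (hx : B.inst (1, l) ∈ (B.probe S j x).1) : x = B.app (1, l) := by
  by_cases hr : ∃ r, B.app r = x
  · obtain ⟨⟨q, l'⟩, rfl⟩ := hr
    rw [probe_app] at hx
    fin_cases q <;> simp [groupList, B.inst_injective.eq_iff] at hx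
    simp [hx]
  · by_cases hi : x = i
    · subst hi
      simp [probe_self, B.inst_injective.eq_iff] at hx
    · rw [probe, Function.update_of_ne hi, B.profile_of_not_exists S hr] at hx
      simp at hx

section probe

variable {S : Fin m → Finset (Fin m)} {j : Fin m} {P : Fin n → Option (Fin n)}

theorem partner_f (hP : IsStable prio (B.probe S j) P) (l : Fin m) : P (B.app (1, l)) = some (B.inst (1, l)) := by
  rcases hP.not_block (B.app (1, l)) 0 (B.inst (1, l)) (by simp [probe_app, groupList])
    with ⟨q, hq, e⟩ | ⟨b, hb, hlt⟩
  · obtain rfl : q = 0 := by omega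
    simpa [probe_app, groupList] using e
  · rw [B.eq_of_mem_probe_w (hP.mem _ _ hb)] at hlt
    exact absurd hlt (lt_irrefl _)

/-- Only f j has higher priority than `i` at h j, and f j is at w j. -/
theorem partner_i (hP : IsStable prio (B.probe S j) P) : P i = some (B.inst (0, j)) := by
  rcases hP.not_block i 0 (B.inst (0, j)) (by simp [probe_self]) with ⟨q, hq, e⟩ | ⟨b, hb, hlt⟩
  · obtain rfl : q = 0 := by omega
    simpa [probe_self] using e
  · by_cases hbf : b = B.app (1, j)
    · rw [hbf, B.partner_f hP] at hb
      simpa using B.inst_injective (Option.some.inj hb)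
    · by_cases hbi : b = i
      · rw [hbi] at hlt
        exact absurd hlt (lt_irrefl _)
      · exact absurd (B.prio_h_i j b hbf hbi) hlt.asymm

/-- Here the list has no w j: h j belongs to `i`, and each c k can only go to a k or e k. -/
theorem partner_d (hP : IsStable prio (B.probe S j) P) : P (B.app (0, j)) = none := by
  by_contra hne
  obtain ⟨h, hd⟩ := Option.ne_none_iff_exists'.mp hne
  have hmem := hP.mem _ _ hd
  simp only [probe_app, groupList, if_true, List.mem_cons, List.mem_map] at hmem
  rcases hmem with rfl | ⟨k, -, rfl⟩
  · exact B.app_ne _ (hP.inj _ _ _ hd (B.partner_i hP))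
  · rcases B.eq_of_partner_c hP (by simp [probe_app, groupList])
      (by simp [probe_app, groupList]) hd with e | e
    · simpa using B.app_injective e
    · simpa using B.app_injective e

/-- Otherwise the unmatched d j, who lists c k, would block with c k, where a k is last. -/
theorem partner_a_ne (hP : IsStable prio (B.probe S j) P) {k : Fin m}
    (hk : k ∈ S j) : P (B.app (2, k)) ≠ some (B.inst (2, k)) := by
  intro ha
  have hmem : B.inst (2, k) ∈ (B.probe S j (B.app (0, j))).1 := by
    simp [probe_app, groupList, B.inst_injective.eq_iff, hk]
  obtain ⟨p, hp⟩ := List.mem_iff_getElem?.mp hmem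
  rcases hP.not_block _ p _ hp with ⟨q, hq, e⟩ | ⟨b, hb, hlt⟩
  · rw [B.partner_d hP, eq_comm, List.getElem?_eq_none_iff] at e
    have := (List.getElem?_eq_some_iff.mp hp).1
    omega
  · obtain rfl := hP.inj _ _ _ ha hb
    exact absurd (B.prio_c_a k _ (B.app_injective.ne (by simp))) hlt.asymm

end probe

/-- The outcome for the four groups of applicants when `i` proposes to `h j`. -/
def groupPartner (S : Fin m → Finset (Fin m)) (j : Fin m) (r : Fin 4 × Fin m) :
    Option (Fin 4 × Fin m) :=
  if r.1 = 0 then if r.2 = j then none else some (0, r.2)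
  else if r.1 = 1 then some (1, r.2)
  else if r.1 = 2 then if r.2 ∈ S j then some (3, r.2) else some (2, r.2)
  else if r.2 ∈ S j then some (2, r.2) else some (3, r.2)

/-- The outcome when `i` proposes to `h j`. -/
noncomputable def probePartner (S : Fin m → Finset (Fin m)) (j : Fin m) : Fin n → Option (Fin n) :=
  Function.extend B.app (fun r => (groupPartner S j r).map B.inst)
    fun x => if x = i then some (B.inst (0, j)) else none

theorem probePartner_app (S : Fin m → Finset (Fin m)) (j : Fin m) (r : Fin 4 × Fin m) :
    B.probePartner S j (B.app r) = (groupPartner S j r).map B.inst :=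
  B.app_injective.extend_apply _ _ _

theorem probePartner_of_not_exists (S : Fin m → Finset (Fin m)) (j : Fin m) {x : Fin n}
    (hx : ¬ ∃ r, B.app r = x) :
    B.probePartner S j x = if x = i then some (B.inst (0, j)) else none :=
  Function.extend_apply' _ _ _ hx

theorem probePartner_self (S : Fin m → Finset (Fin m)) (j : Fin m) :
    B.probePartner S j i = some (B.inst (0, j)) := by
  rw [probePartner_of_not_exists _ _ _ (by simpa using B.app_ne), if_pos rfl]

theorem groupPartner_injective {S : Fin m → Finset (Fin m)} {j : Fin m} {r r' s : Fin 4 × Fin m}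
    (h : groupPartner S j r = some s) (h' : groupPartner S j r' = some s) : r = r' := by
  obtain ⟨q, l⟩ := r
  obtain ⟨q', l'⟩ := r'
  obtain ⟨u, l''⟩ := s
  unfold groupPartner at h h'
  fin_cases q <;> fin_cases q' <;> simp at h h' ⊢ <;> grind

theorem groupPartner_ne {S : Fin m → Finset (Fin m)} {j : Fin m} (r : Fin 4 × Fin m) :
    groupPartner S j r ≠ some (0, j) := by
  unfold groupPartner
  grind

theorem isStable_probePartner (S : Fin m → Finset (Fin m)) (j : Fin m) :
    IsStable prio (B.probe S j) (B.probePartner S j) where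
  inj x y h hx hy := by
    have main : ∀ x h, B.probePartner S j x = some h → x = i ∧ h = B.inst (0, j) ∨
        ∃ r s, B.app r = x ∧ B.inst s = h ∧ groupPartner S j r = some s := by
      intro x h hx
      by_cases hr : ∃ r, B.app r = x
      · obtain ⟨r, rfl⟩ := hr
        rw [probePartner_app, Option.map_eq_some_iff] at hx
        obtain ⟨s, hs, rfl⟩ := hx
        exact Or.inr ⟨r, s, rfl, rfl, hs⟩
      · rw [probePartner_of_not_exists _ _ _ hr] at hx
        split_ifs at hx with hi
        exact Or.inl ⟨hi, (Option.some.inj hx).symm⟩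
    rcases main x h hx with ⟨rfl, rfl⟩ | ⟨r, s, rfl, rfl, hr⟩
    · rcases main y _ hy with ⟨rfl, -⟩ | ⟨r, s, rfl, hs, hr⟩
      · rfl
      · rw [B.inst_injective hs] at hr
        exact absurd hr (groupPartner_ne r)
    · rcases main y _ hy with ⟨rfl, hs⟩ | ⟨r', s', rfl, hs, hr'⟩
      · rw [B.inst_injective hs] at hr
        exact absurd hr (groupPartner_ne r)
      · rw [B.inst_injective hs] at hr'
        rw [groupPartner_injective hr hr']
  mem x h hx := by
    by_cases hr : ∃ r, B.app r = x
    · obtain ⟨⟨q, l⟩, rfl⟩ := hr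
      rw [probePartner_app] at hx
      rw [probe_app]
      fin_cases q <;> simp [groupPartner] at hx <;> simp [groupList] <;> grind
    · rw [probePartner_of_not_exists _ _ _ hr] at hx
      split_ifs at hx with hi
      rw [hi, probe_self]
      simpa using (Option.some.inj hx).symm
  not_block x p h hp := by
    by_cases hr : ∃ r, B.app r = x
    · obtain ⟨⟨q, l⟩, rfl⟩ := hr
      rw [probe_app] at hp
      rw [probe_app, probePartner_app]
      have hea : B.app (3, l) ≠ B.app (2, l) := B.app_injective.ne (by simp)
      match q with
      | 0 =>
        by_cases hl : l = j
        · subst hl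
          -- Every institution listed by the unmatched d j holds somebody better: h j holds `i`, and
          -- each c k holds e k.
          right
          have hmem := List.mem_of_getElem? hp
          simp only [groupList, if_true, List.mem_cons, List.mem_map, Finset.mem_toList] at hmem
          rcases hmem with rfl | ⟨k, hk, rfl⟩
          · exact ⟨i, B.probePartner_self S l,
              B.prio_h_i l _ (B.app_injective.ne (by simp)) (B.app_ne _)⟩
          · exact ⟨B.app (3, k), by simp [probePartner_app, groupPartner, hk],
              B.prio_c_e k _ (B.app_injective.ne (by simp))⟩
        · exact Or.inl ⟨0, Nat.zero_le _, by simp [groupPartner, groupList, hl]⟩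
      | 1 => exact Or.inl ⟨0, Nat.zero_le _, by simp [groupPartner, groupList]⟩
      | 2 =>
        by_cases hl : l ∈ S j
        · rcases p with _ | p
          · obtain rfl : B.inst (2, l) = h := by simpa [groupList] using hp
            exact Or.inr ⟨B.app (3, l), by simp [probePartner_app, groupPartner, hl],
              B.prio_c_a l _ hea⟩
          · exact Or.inl ⟨1, by omega, by simp [groupPartner, groupList, hl]⟩
        · exact Or.inl ⟨0, Nat.zero_le _, by simp [groupPartner, groupList, hl]⟩
      | 3 =>
        by_cases hl : l ∈ S j
        · rcases p with _ | p
          · obtain rfl : B.inst (3, l) = h := by simpa [groupList] using hp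
            exact Or.inr ⟨B.app (2, l), by simp [probePartner_app, groupPartner, hl],
              B.prio_y l _ hea⟩
          · exact Or.inl ⟨1, by omega, by simp [groupPartner, groupList, hl]⟩
        · exact Or.inl ⟨0, Nat.zero_le _, by simp [groupPartner, groupList, hl]⟩
    · by_cases hi : x = i
      · subst hi
        exact Or.inl ⟨0, Nat.zero_le _, by simp [probePartner_self, probe_self]⟩
      · rw [probe, Function.update_of_ne hi, B.profile_of_not_exists S hr] at hp
        simp at hp

/-- The bit `k ∈ S j` can be read off the outcome when `i` lists only h j, which is what makes the
encoding injective. -/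
theorem DA_probe_partner_a_iff (S : Fin m → Finset (Fin m)) (j k : Fin m) :
    (DA prio (B.probe S j)).partner (B.app (2, k)) = some (B.inst (2, k)) ↔ k ∉ S j := by
  refine ⟨fun h hk => B.partner_a_ne (DA_isStable _ _) hk h, fun hk => ?_⟩
  have hle := daFinal_rejections_le (B.isStable_probePartner S j) (a := B.app (2, k))
    (h := B.inst (2, k)) (p := 0) (by simp [probePartner_app, groupPartner, hk])
    (by simp [probe_app, groupList])
  rw [DA_partner_eq_getElem?, Nat.le_zero.mp hle]
  simp [probe_app, groupList]

theorem mul_self_le_memory (B : BitMarket m prio i) (D : ExtensiveFormDescription n) (hD : D.IsApplicantProposing)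
    (hDA : D.IsIndividualizedDictatorship (DA prio) i) : (m : ℝ) * m ≤ D.memory := by
  -- The profiles of the family differ only in the lists of the d j.
  have h := D.logb_card_le_memory hD hDA B.profile (Set.range fun j => B.app (0, j)) ?_ ?_ ?_
  · have hcard : Fintype.card (Fin m → Finset (Fin m)) = 2 ^ (m * m) := by
      simp [pow_mul]
    rw [hcard] at h
    push_cast at h
    rw [← Real.rpow_natCast, Real.logb_rpow (by norm_num) (by norm_num)] at h
    exact_mod_cast h
  · intro S S' x hx
    apply Subtype.ext
    by_cases hr : ∃ r, B.app r = x
    · obtain ⟨⟨q, l⟩, rfl⟩ := hr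
      have hq : q ≠ 0 := by
        rintro rfl
        exact hx ⟨l, rfl⟩
      simp [profile_app, groupList, hq]
    · rw [B.profile_of_not_exists S hr, B.profile_of_not_exists S' hr]
  · rintro S _ ⟨j, rfl⟩
    refine ⟨B.longList S j, fun p hp => ?_, fun hmenu => ?_⟩
    · rw [profile_app] at hp ⊢
      exact List.getElem?_append_left hp
    · have hin : some (B.inst (0, j)) ∈ menu (DA prio) i (B.profile S) :=
        ⟨B.single j, B.partner_i (DA_isStable prio (B.probe S j))⟩
      rw [← hmenu] at hin
      obtain ⟨s, hs⟩ := hin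
      refine B.partner_ne_of_longList (S := S) (j := j) (fun r hr => ?_) ?_ (DA_isStable prio _) hs
      · rw [Function.update_of_ne (B.app_ne r), Function.update_of_ne (B.app_injective.ne hr),
          profile_app]
      · rw [Function.update_of_ne (B.app_ne _), Function.update_self]
  · intro S S' h
    funext j
    ext k
    have e := h (B.single j)
    have h1 := B.DA_probe_partner_a_iff S j k
    have h2 := B.DA_probe_partner_a_iff S' j k
    rw [probe] at h1 h2
    rw [e] at h1
    exact not_iff_not.mp (h1.symm.trans h2)

end BitMarket

/-! ### Asymptotics in the market size -/

theorem exists_prio_le_memory {n m : ℕ} (hm : 4 * m + 1 ≤ n) (i : Fin n) :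
    ∃ prio : Priorities n, ∀ D : ExtensiveFormDescription n, D.IsApplicantProposing →
      D.IsIndividualizedDictatorship (DA prio) i → (m : ℝ) * m ≤ D.memory := by
  obtain ⟨prio, ⟨B⟩⟩ := exists_bitMarket hm i
  exact ⟨prio, B.mul_self_le_memory⟩

theorem not_frequently_sq_le_of_isBigO {c : ℝ} (hc : 0 < c) {f : ℕ → ℝ} {k : ℕ}
    (hf : f =O[Filter.atTop] (fun n : ℕ => (n : ℝ) * Real.log n ^ k)) :
    ¬ ∃ᶠ n : ℕ in Filter.atTop, c * (n : ℝ) ^ 2 ≤ f n := by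
  have hlog : (fun n : ℕ => Real.log n ^ k) =o[Filter.atTop] (fun n : ℕ => (n : ℝ)) :=
    Real.isLittleO_pow_log_id_atTop.comp_tendsto tendsto_natCast_atTop_atTop
  have hmul := (Asymptotics.isBigO_refl (fun n : ℕ => (n : ℝ)) Filter.atTop).mul_isLittleO hlog
  have hlt := (hf.trans_isLittleO hmul).bound (half_pos hc)
  rw [Filter.not_frequently]
  filter_upwards [hlt, Filter.eventually_gt_atTop 0] with n hn hpos
  have hpos' : (0 : ℝ) < n := by exact_mod_cast hpos
  rw [not_le]
  -- The factor `n * log n ^ k` is `o(n * n)`; the constant `c / 2` leaves room for a strict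
  -- inequality.
  have h1 : f n ≤ c / 2 * ((n : ℝ) * n) := by
    refine (le_abs_self _).trans (hn.trans_eq ?_)
    rw [Real.norm_of_nonneg (by positivity)]
  nlinarith [mul_pos hc (mul_pos hpos' hpos')]

theorem theorem3 :
    ∃ prio : (n : ℕ) → Fin n → Priorities n,
      (∃ c : ℝ, 0 < c ∧ ∃ N : ℕ, ∀ n : ℕ, N ≤ n → ∀ (i : Fin n) (D : ExtensiveFormDescription n),
        D.IsApplicantProposing → D.IsIndividualizedDictatorship (DA (prio n i)) i →
          c * (n : ℝ) ^ 2 ≤ D.memory) ∧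
      (∀ i : (n : ℕ) → 0 < n → Fin n, ¬ ∃ D : (n : ℕ) → ExtensiveFormDescription n,
        IsApplicantLinear D ∧
          ∃ᶠ n in Filter.atTop, ∃ hn : 0 < n,
            (D n).IsIndividualizedDictatorship (DA (prio n (i n hn))) (i n hn)) := by
  have hm : ∀ n, Fin n → 4 * ((n - 1) / 4) + 1 ≤ n := fun n i => by
    have := i.pos
    omega
  choose prio hprio using fun n (i : Fin n) => exists_prio_le_memory (hm n i) i
  have main : ∀ n : ℕ, 5 ≤ n → ∀ (i : Fin n) (D : ExtensiveFormDescription n),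
      D.IsApplicantProposing → D.IsIndividualizedDictatorship (DA (prio n i)) i →
        1 / 64 * (n : ℝ) ^ 2 ≤ D.memory := by
    intro n hn i D hD hDA
    refine le_trans ?_ (hprio n i D hD hDA)
    -- With `m = (n - 1) / 4` and `5 ≤ n` one has `n ≤ 8 * m`, whence the constant `1 / 64`.
    have h8 : n ≤ 8 * ((n - 1) / 4) := by omega
    have h8' : (n : ℝ) ≤ 8 * ((n - 1) / 4 : ℕ) := by exact_mod_cast h8
    have hn0 : (0 : ℝ) ≤ n := Nat.cast_nonneg n
    nlinarith
  refine ⟨prio, ⟨1 / 64, by norm_num, 5, main⟩, ?_⟩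
  rintro i ⟨D, ⟨hD, k, hmem⟩, hfreq⟩
  refine not_frequently_sq_le_of_isBigO (c := 1 / 64) (by norm_num) hmem ?_
  refine (hfreq.and_eventually (Filter.eventually_ge_atTop 5)).mono ?_
  rintro n ⟨⟨hn, hDA⟩, h5⟩
  exact main n h5 _ _ (hD n) hDA
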